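/- For a partition $\pi$ of an integer $n\ge 0$ and positive integers $A,a$, let $\mathrm{mex}_{A,a}(\pi)$ be the smallest integer that is $\ge a$, congruent to $a$ modulo $A$, and not a part of $\pi$. Let $p_{A,a}(n)$ (respectively $\overline{p}_{A,a}(n)$) be the number of partitions $\pi$ of $n$ with $\mathrm{mex}_{A,a}(\pi)\equiv a \pmod{2A}$ (respectively $\mathrm{mex}_{A,a}(\pi)\equiv A+a\pmod{2A}$). The rank of a non-empty partition is its largest part minus its number of parts; the empty partition has no rank, so that the number of partitions of $0$ with rank $m$ is $0$ for every $m$. Then: 1. For all integers $j\ge 0$ and $n\ge 0$, $\overline{p}_{3,j+1}(n)$ equals the number of partitions of $n$ with rank $\ge j$. 2. For all integers $j\ge 0$ and $n\ge 1$, $p_{3,j+1}(n)$ equals the number of partitions of $n$ with rank $<j$. 3. For every integer $n\ge 1$, $p_{3,3}(n)$ equals the number of partitions of $n$ with rank $\ge -1$. 4. For every integer $n\ge 0$, $\overline{p}_{3,3}(n)$ equals the number of Garden of Eden partitions of $n$, that is, of partitions of $n$ with rank $\le -2$. -/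

import Mathlib

namespace MexRank

/-- `mex_{A,a}(π)`: the smallest integer `≥ a`, congruent to `a` modulo `A`, that is not a part
of `π`. For `A ≥ 1` the set below is non-empty, so the infimum is a minimum. -/
noncomputable def mex (A a : ℕ) {n : ℕ} (π : n.Partition) : ℕ :=
  sInf {m : ℕ | a ≤ m ∧ m ≡ a [MOD A] ∧ m ∉ π.parts}

/-- `p_{A,a}(n)`: the number of partitions `π` of `n` with `mex_{A,a}(π) ≡ a (mod 2A)`. -/
noncomputable def p (A a n : ℕ) : ℕ :=
  (Finset.univ.filter fun π : n.Partition => mex A a π ≡ a [MOD 2 * A]).card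

/-- `p̄_{A,a}(n)`: the number of partitions `π` of `n` with `mex_{A,a}(π) ≡ A + a (mod 2A)`. -/
noncomputable def pbar (A a n : ℕ) : ℕ :=
  (Finset.univ.filter fun π : n.Partition => mex A a π ≡ A + a [MOD 2 * A]).card

/-- The largest part of a partition (only used for non-empty partitions). -/
def largestPart {n : ℕ} (π : n.Partition) : ℕ := π.parts.sup

/-- The rank of a (non-empty) partition: the largest part minus the number of parts. -/
def rank {n : ℕ} (π : n.Partition) : ℤ := (largestPart π : ℤ) - (Multiset.card π.parts : ℤ)

/-- The number of partitions of `n` whose rank satisfies `P`. The empty partition has no largest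
part, hence no rank, and is not counted (the usual convention `N(m,0) = 0` for every `m`). -/
def rankCount (P : ℤ → Prop) [DecidablePred P] (n : ℕ) : ℕ :=
  (Finset.univ.filter fun π : n.Partition => π.parts ≠ 0 ∧ P (rank π)).card

/-- The number of Garden of Eden partitions of `n`: those of rank `-2` or less. -/
def gardenOfEden (n : ℕ) : ℕ := rankCount (fun r => r ≤ -2) n

end MexRank

namespace MexRank

/-! ### The mex recursion -/

section Mex

variable {A a n m : ℕ}

/-! A partition counted by `pbar` must contain `a`, and deleting one copy of it only moves the start
of the mex search to `a + A` (`pbar_add`). Since `p` and `pbar` are complementary, `f j n = pbar 3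
(j + 1) n` satisfies `f j (m + (j + 1)) + f (j + 3) m = #partitions of m` and vanishes for `n < j +
1`; this determines `f`. Dyson's map `card_dyson`, trading the first column for a row, shows that
the counts of rank `≥ j` and of rank `≤ -j` obey the same recursion, with shifts `r = j + 1` and `r
= -(j + 1)`. The claims about `p` follow by complementation. -/

theorem mex_set_nonempty (hA : 0 < A) (π : n.Partition) :
    {m : ℕ | a ≤ m ∧ m ≡ a [MOD A] ∧ m ∉ π.parts}.Nonempty := by
  refine ⟨a + A * (n + 1), Nat.le_add_right _ _, by simp [Nat.ModEq], fun h => ?_⟩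
  have h1 := Multiset.le_sum_of_mem h
  rw [π.parts_sum] at h1
  nlinarith

theorem mex_spec (hA : 0 < A) (π : n.Partition) :
    a ≤ mex A a π ∧ mex A a π ≡ a [MOD A] ∧ mex A a π ∉ π.parts :=
  Nat.sInf_mem (mex_set_nonempty hA π)

theorem mex_of_notMem {π : n.Partition} (hA : 0 < A) (h : a ∉ π.parts) : mex A a π = a :=
  le_antisymm (Nat.sInf_le ⟨le_rfl, rfl, h⟩) (mex_spec hA π).1

theorem mex_of_mem {π : n.Partition} {μ : m.Partition} (h : π.parts = a ::ₘ μ.parts) (hA : 0 < A) :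
    mex A a π = mex A (a + A) μ := by
  unfold mex
  congr 1
  ext x
  simp only [Set.mem_ofPred_eq, h, Multiset.mem_cons, not_or]
  constructor
  · rintro ⟨h1, h2, h3, h4⟩
    refine ⟨?_, h2.trans (by simp [Nat.ModEq]), h4⟩
    obtain ⟨k, hk⟩ := (Nat.modEq_iff_dvd' h1).1 h2.symm
    have : k ≠ 0 := by rintro rfl; omega
    have := Nat.le_mul_of_pos_right A (Nat.pos_of_ne_zero this)
    omega
  · rintro ⟨h1, h2, h3⟩
    exact ⟨by omega, h2.trans (by simp [Nat.ModEq]), by omega, h3⟩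

/-- Writing `x = A * k + a`, the two classes are `k` even and `k` odd. -/
theorem modEq_two_mul_iff_not {x : ℕ} (hA : 0 < A) (h : x ≡ a [MOD A]) (hx : a ≤ x) :
    x ≡ a [MOD 2 * A] ↔ ¬ x ≡ A + a [MOD 2 * A] := by
  obtain ⟨k, hk⟩ := (Nat.modEq_iff_dvd' hx).1 h.symm
  obtain rfl : x = A * k + a := by omega
  rw [Nat.ModEq.comm, Nat.modEq_iff_dvd, Nat.ModEq.comm, Nat.modEq_iff_dvd]
  have hA' : (A : ℤ) ≠ 0 := by omega
  have e1 : ((A * k + a : ℕ) : ℤ) - a = A * k := by push_cast; ring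
  have e2 : ((A * k + a : ℕ) : ℤ) - (A + a : ℕ) = A * (k - 1) := by push_cast; ring
  have e3 : ((2 * A : ℕ) : ℤ) = A * 2 := by push_cast; ring
  rw [e1, e2, e3, mul_dvd_mul_iff_left hA', mul_dvd_mul_iff_left hA']
  omega

theorem p_add_pbar (hA : 0 < A) : p A a n + pbar A a n = Fintype.card n.Partition := by
  have h : ∀ π : n.Partition, mex A a π ≡ a [MOD 2 * A] ↔ ¬ mex A a π ≡ A + a [MOD 2 * A] :=
    fun π => modEq_two_mul_iff_not hA (mex_spec hA π).2.1 (mex_spec hA π).1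
  unfold p pbar
  simp_rw [h]
  rw [add_comm, Finset.card_filter_add_card_filter_not, Finset.card_univ]

theorem mem_of_mex_modEq {π : n.Partition} (hA : 0 < A) (h : mex A a π ≡ A + a [MOD 2 * A]) :
    a ∈ π.parts := by
  by_contra ha
  have h1 := mex_spec (a := a) hA π
  exact (modEq_two_mul_iff_not hA h1.2.1 h1.1).1 (by rw [mex_of_notMem hA ha]) h

theorem pbar_of_lt (hA : 0 < A) (hn : n < a) : pbar A a n = 0 := by
  rw [pbar, Finset.card_eq_zero, Finset.filter_eq_empty_iff]
  intro π _ h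
  have := Multiset.le_sum_of_mem (mem_of_mex_modEq hA h)
  rw [π.parts_sum] at this
  omega

/-- Removing one copy of the part `a` turns the partitions counted by `pbar A a` into those
counted by `p A (a + A)`. -/
theorem pbar_add (hA : 0 < A) (ha : 0 < a) : pbar A a (m + a) = p A (a + A) m := by
  have key : ∀ (π : (m + a).Partition) (μ : m.Partition), π.parts = a ::ₘ μ.parts →
      (mex A a π ≡ A + a [MOD 2 * A] ↔ mex A (a + A) μ ≡ a + A [MOD 2 * A]) := by
    intro π μ h
    rw [mex_of_mem h hA, add_comm a A]
  have rem : ∀ π : (m + a).Partition, a ∈ π.parts → (π.parts.erase a).sum = m := by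
    intro π h
    have := Multiset.sum_erase h
    rw [π.parts_sum] at this
    omega
  unfold pbar p
  refine Finset.card_bij'
    (fun π hπ => ⟨π.parts.erase a, fun h => π.parts_pos (Multiset.mem_of_mem_erase h),
      rem π (mem_of_mex_modEq hA (Finset.mem_filter.1 hπ).2)⟩)
    (fun μ _ => ⟨a ::ₘ μ.parts, fun h => (Multiset.mem_cons.1 h).elim (fun e => e ▸ ha)
      (fun h => μ.parts_pos h), by rw [Multiset.sum_cons, μ.parts_sum, add_comm]⟩) ?_ ?_ ?_ ?_
  · intro π hπ
    have h := (Finset.mem_filter.1 hπ).2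
    exact Finset.mem_filter.2 ⟨Finset.mem_univ _,
      (key _ _ (Multiset.cons_erase (mem_of_mex_modEq hA h)).symm).1 h⟩
  · intro μ hμ
    exact Finset.mem_filter.2 ⟨Finset.mem_univ _, (key _ _ rfl).2 (Finset.mem_filter.1 hμ).2⟩
  · intro π hπ
    exact Nat.Partition.ext
      (Multiset.cons_erase (mem_of_mex_modEq hA (Finset.mem_filter.1 hπ).2))
  · intro μ _
    exact Nat.Partition.ext (Multiset.erase_cons_head _ _)

end Mex

/-! ### Dyson's map on multisets of parts -/

section Dyson

theorem sum_map_pred_add_card {s : Multiset ℕ} (hs : ∀ x ∈ s, 0 < x) :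
    (s.map Nat.pred).sum + s.card = s.sum := by
  induction s using Multiset.induction with
  | empty => simp
  | cons x s ih =>
    have h1 := ih fun y hy => hs y (Multiset.mem_cons_of_mem hy)
    have h2 := hs x (Multiset.mem_cons_self x s)
    simp only [Multiset.map_cons, Multiset.sum_cons, Multiset.card_cons, Nat.pred_eq_sub_one] at *
    omega

theorem sum_map_succ (s : Multiset ℕ) : (s.map Nat.succ).sum = s.sum + s.card := by
  induction s using Multiset.induction with
  | empty => simp
  | cons x s ih => simp [ih]; omega

/-- Removing the first column of `s` and adding a row of length `c`. -/
def columnToRow (c : ℕ) (s : Multiset ℕ) : Multiset ℕ :=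
  (c ::ₘ s.map Nat.pred).filter (· ≠ 0)

/-- Removing the first row of `t` and adding a column of length `k`. -/
def rowToColumn (k : ℕ) (t : Multiset ℕ) : Multiset ℕ :=
  (t.erase t.sup).map Nat.succ + Multiset.replicate (k - (t.erase t.sup).card) 1

theorem sup_mem {t : Multiset ℕ} (ht : t ≠ 0) : t.sup ∈ t := by
  induction t using Multiset.induction with
  | empty => exact absurd rfl ht
  | cons x t ih =>
    by_cases h : t = 0
    · simp [h]
    · rw [Multiset.sup_cons, Multiset.mem_cons]
      rcases le_total x t.sup with h' | h'
      · exact Or.inr (by rw [sup_eq_right.2 h']; exact ih h)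
      · exact Or.inl (sup_eq_left.2 h')

theorem card_erase_sup (t : Multiset ℕ) : (t.erase t.sup).card = t.card - 1 := by
  by_cases h : t = 0
  · simp [h]
  · rw [Multiset.card_erase_of_mem (sup_mem h), Nat.pred_eq_sub_one]

theorem sum_columnToRow {c : ℕ} {s : Multiset ℕ} (hs : ∀ x ∈ s, 0 < x) :
    (columnToRow c s).sum + s.card = c + s.sum := by
  have h := congrArg Multiset.sum (Multiset.filter_add_not (· ≠ 0) (c ::ₘ s.map Nat.pred))
  rw [Multiset.sum_add, Multiset.sum_eq_zero (s := Multiset.filter (¬ · ≠ 0) _)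
    fun x hx => not_not.1 (Multiset.mem_filter.1 hx).2, add_zero] at h
  rw [columnToRow, h, Multiset.sum_cons, add_assoc, sum_map_pred_add_card hs]

theorem pos_of_mem_columnToRow {c x : ℕ} {s : Multiset ℕ} (h : x ∈ columnToRow c s) : 0 < x :=
  Nat.pos_of_ne_zero (Multiset.mem_filter.1 h).2

theorem card_columnToRow_le (c : ℕ) (s : Multiset ℕ) : (columnToRow c s).card ≤ s.card + 1 :=
  (Multiset.card_le_card (Multiset.filter_le _ _)).trans (by simp)

theorem sup_columnToRow {c : ℕ} {s : Multiset ℕ} (h : s.sup ≤ c + 1) :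
    (columnToRow c s).sup = c := by
  apply le_antisymm
  · refine Multiset.sup_le.2 fun x hx => ?_
    rcases Multiset.mem_cons.1 (Multiset.mem_filter.1 hx).1 with rfl | hx
    · exact le_rfl
    · obtain ⟨y, hy, rfl⟩ := Multiset.mem_map.1 hx
      exact Nat.pred_le_iff.2 ((Multiset.le_sup hy).trans h)
  · rcases Nat.eq_zero_or_pos c with rfl | hc
    · exact Nat.zero_le _
    · exact Multiset.le_sup
        (Multiset.mem_filter.2 ⟨Multiset.mem_cons_self _ _, Nat.ne_of_gt hc⟩)

/-- The bound on `s.sup` makes the new row a largest part, so erasing the supremum undoes its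
insertion. Parts `1` were lost as zeros; `s.card` tells how many to restore. -/
theorem rowToColumn_columnToRow {c : ℕ} {s : Multiset ℕ} (hs : ∀ x ∈ s, 0 < x)
    (h : s.sup ≤ c + 1) : rowToColumn s.card (columnToRow c s) = s := by
  have he : (columnToRow c s).erase c = (s.map Nat.pred).filter (· ≠ 0) := by
    rcases Nat.eq_zero_or_pos c with rfl | hc
    -- A row of length `0` is filtered out, so there is nothing to erase.
    · rw [Multiset.erase_of_notMem fun hx => lt_irrefl 0 (pos_of_mem_columnToRow hx), columnToRow,
        Multiset.filter_cons_of_neg _ (by simp)]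
    · rw [columnToRow, Multiset.filter_cons_of_pos (p := (· ≠ 0)) _ hc.ne', Multiset.erase_cons_head]
  have hz : (s.map Nat.pred).filter (¬ · ≠ 0) =
      Multiset.replicate (s.card - ((s.map Nat.pred).filter (· ≠ 0)).card) 0 := by
    rw [Multiset.eq_replicate]
    refine ⟨?_, fun x hx => not_not.1 (Multiset.mem_filter.1 hx).2⟩
    have := congrArg Multiset.card (Multiset.filter_add_not (· ≠ 0) (s.map Nat.pred))
    rw [Multiset.card_add, Multiset.card_map] at this
    omega
  have hsucc : (s.map Nat.pred).map Nat.succ = s := by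
    rw [Multiset.map_map]
    conv_rhs => rw [← Multiset.map_id s]
    exact Multiset.map_congr rfl fun x hx => Nat.succ_pred_eq_of_pos (hs x hx)
  rw [rowToColumn, sup_columnToRow h, he]
  conv_rhs => rw [← hsucc, ← Multiset.filter_add_not (· ≠ 0) (s.map Nat.pred), hz,
    Multiset.map_add, Multiset.map_replicate]

theorem columnToRow_rowToColumn {k : ℕ} {t : Multiset ℕ} (ht : ∀ x ∈ t, 0 < x) :
    columnToRow t.sup (rowToColumn k t) = t := by
  have h0 : t.filter (· ≠ 0) = t :=
    Multiset.filter_eq_self.2 fun x hx => Nat.ne_of_gt (ht x hx)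
  have hr (l : ℕ) : (Multiset.replicate l 0).filter (· ≠ 0) = 0 :=
    Multiset.filter_eq_nil.2 fun x hx => not_not.2 (Multiset.eq_of_mem_replicate hx)
  have hp : (rowToColumn k t).map Nat.pred =
      t.erase t.sup + Multiset.replicate (k - (t.erase t.sup).card) 0 := by
    simp [rowToColumn]
  rw [columnToRow, hp, ← Multiset.cons_add, Multiset.filter_add, hr, add_zero]
  by_cases h : t = 0
  · simp [h]
  · rw [Multiset.cons_erase (sup_mem h), h0]

theorem pos_of_mem_rowToColumn {k x : ℕ} {t : Multiset ℕ} (h : x ∈ rowToColumn k t) : 0 < x := by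
  rcases Multiset.mem_add.1 h with h | h
  · obtain ⟨y, -, rfl⟩ := Multiset.mem_map.1 h
    exact Nat.succ_pos y
  · rw [Multiset.eq_of_mem_replicate h]
    exact one_pos

theorem card_rowToColumn {k : ℕ} {t : Multiset ℕ} (h : t.card ≤ k + 1) :
    (rowToColumn k t).card = k := by
  have := card_erase_sup t
  rw [rowToColumn, Multiset.card_add, Multiset.card_map, Multiset.card_replicate]
  omega

theorem sum_rowToColumn {k : ℕ} {t : Multiset ℕ} (h : t.card ≤ k + 1) :
    (rowToColumn k t).sum + t.sup = k + t.sum := by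
  have h1 := card_erase_sup t
  have h2 : t.sup + (t.erase t.sup).sum = t.sum := by
    by_cases h : t = 0
    · simp [h]
    · exact Multiset.sum_erase (sup_mem h)
  rw [rowToColumn, Multiset.sum_add, sum_map_succ, Multiset.sum_replicate, smul_eq_mul, mul_one]
  omega

theorem sup_rowToColumn_le (k : ℕ) (t : Multiset ℕ) : (rowToColumn k t).sup ≤ t.sup + 1 := by
  refine Multiset.sup_le.2 fun x hx => ?_
  rcases Multiset.mem_add.1 hx with h | h
  · obtain ⟨y, hy, rfl⟩ := Multiset.mem_map.1 h
    exact Nat.succ_le_succ (Multiset.le_sup (Multiset.mem_of_mem_erase hy))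
  · rw [Multiset.eq_of_mem_replicate h]
    exact Nat.le_add_left _ _

/-- Dyson's map: replacing the first column, of length `ℓ`, by a row of length `ℓ + r`. -/
theorem card_dyson {n m : ℕ} {r : ℤ} (h : (m : ℤ) = n + r) :
    (Finset.univ.filter fun π : n.Partition =>
      0 ≤ (π.parts.card : ℤ) + r ∧ (largestPart π : ℤ) ≤ π.parts.card + r + 1).card =
    (Finset.univ.filter fun μ : m.Partition =>
      r ≤ (largestPart μ : ℤ) ∧ (μ.parts.card : ℤ) ≤ largestPart μ - r + 1).card := by
  unfold largestPart
  refine Finset.card_bij'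
    (fun π hπ => ⟨columnToRow (π.parts.card + r).toNat π.parts, pos_of_mem_columnToRow, ?_⟩)
    (fun μ hμ => ⟨rowToColumn (μ.parts.sup - r).toNat μ.parts, pos_of_mem_rowToColumn, ?_⟩)
    ?_ ?_ ?_ ?_
  · have h1 := (Finset.mem_filter.1 hπ).2
    have h2 := sum_columnToRow (c := (π.parts.card + r).toNat) (fun x hx => π.parts_pos hx)
    rw [π.parts_sum] at h2
    omega
  · have h1 := (Finset.mem_filter.1 hμ).2
    have h2 := sum_rowToColumn (k := (μ.parts.sup - r).toNat) (t := μ.parts) (by omega)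
    rw [μ.parts_sum] at h2
    omega
  · intro π hπ
    have h1 := (Finset.mem_filter.1 hπ).2
    have h2 := sup_columnToRow (c := (π.parts.card + r).toNat) (s := π.parts) (by omega)
    have h3 := card_columnToRow_le (π.parts.card + r).toNat π.parts
    refine Finset.mem_filter.2 ⟨Finset.mem_univ _, ?_⟩
    dsimp only
    omega
  · intro μ hμ
    have h1 := (Finset.mem_filter.1 hμ).2
    have h2 := card_rowToColumn (k := (μ.parts.sup - r).toNat) (t := μ.parts) (by omega)
    have h3 := sup_rowToColumn_le (μ.parts.sup - r).toNat μ.parts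
    refine Finset.mem_filter.2 ⟨Finset.mem_univ _, ?_⟩
    dsimp only
    omega
  · intro π hπ
    have h1 := (Finset.mem_filter.1 hπ).2
    have h2 := sup_columnToRow (c := (π.parts.card + r).toNat) (s := π.parts) (by omega)
    -- The new largest part minus `r` recovers the length of the removed column.
    have h3 : (((π.parts.card + r).toNat : ℕ) - r : ℤ).toNat = π.parts.card := by omega
    refine Nat.Partition.ext ?_
    dsimp only
    rw [h2, h3]
    exact rowToColumn_columnToRow (fun x hx => π.parts_pos hx) (by omega)
  · intro μ hμ
    have h1 := (Finset.mem_filter.1 hμ).2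
    have h2 := card_rowToColumn (k := (μ.parts.sup - r).toNat) (t := μ.parts) (by omega)
    have h3 : (((μ.parts.sup - r).toNat : ℕ) + r : ℤ).toNat = μ.parts.sup := by omega
    refine Nat.Partition.ext ?_
    dsimp only
    rw [h2, h3]
    exact columnToRow_rowToColumn (fun x hx => μ.parts_pos hx)

end Dyson

/-! ### The recursion for rank counts -/

section RankCount

variable {n : ℕ}

theorem parts_ne_zero_iff_card (π : n.Partition) : π.parts ≠ 0 ↔ 1 ≤ π.parts.card :=
  Multiset.card_pos.symm

theorem parts_ne_zero_iff_largestPart (π : n.Partition) : π.parts ≠ 0 ↔ 1 ≤ largestPart π := by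
  constructor
  · exact fun h => π.parts_pos (sup_mem h)
  · intro h h0
    simp [largestPart, h0] at h

theorem largestPart_le (π : n.Partition) : largestPart π ≤ n :=
  Multiset.sup_le.2 fun _ hx => (Multiset.le_sum_of_mem hx).trans_eq π.parts_sum

theorem card_parts_le (π : n.Partition) : π.parts.card ≤ n := by
  have := sum_map_pred_add_card (s := π.parts) (fun x hx => π.parts_pos hx)
  rw [π.parts_sum] at this
  omega

/-- The complement keeps the empty partition, so the recursions also hold at `m = 0`. -/
theorem rankCount_add_card_not (P : ℤ → Prop) [DecidablePred P] :
    rankCount P n + (Finset.univ.filter fun π : n.Partition =>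
      ¬ (π.parts ≠ 0 ∧ P (rank π))).card = Fintype.card n.Partition := by
  rw [rankCount, Finset.card_filter_add_card_filter_not, Finset.card_univ]

theorem rankCount_add_not (P : ℤ → Prop) [DecidablePred P] (hn : 1 ≤ n) :
    rankCount P n + rankCount (fun r => ¬ P r) n = Fintype.card n.Partition := by
  rw [← rankCount_add_card_not P]
  unfold rankCount
  congr 2
  refine Finset.filter_congr fun π _ => ?_
  have : π.parts ≠ 0 := fun h => by
    have := π.parts_sum
    rw [h, Multiset.sum_zero] at this
    omega
  tauto

theorem rankCount_ge_of_lt {j : ℕ} (h : n < j + 1) : rankCount (fun r => (j : ℤ) ≤ r) n = 0 := by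
  rw [rankCount, Finset.card_eq_zero, Finset.filter_eq_empty_iff]
  rintro π - ⟨h1, h2⟩
  rw [parts_ne_zero_iff_card] at h1
  have := largestPart_le π
  unfold rank at h2
  omega

theorem rankCount_le_neg_of_lt {j : ℕ} (h : n < j + 1) :
    rankCount (fun r => r ≤ -(j : ℤ)) n = 0 := by
  rw [rankCount, Finset.card_eq_zero, Finset.filter_eq_empty_iff]
  rintro π - ⟨h1, h2⟩
  rw [parts_ne_zero_iff_largestPart] at h1
  have := card_parts_le π
  unfold rank at h2
  omega

theorem rankCount_ge_add (j m : ℕ) :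
    rankCount (fun r => (j : ℤ) ≤ r) (m + (j + 1)) +
      rankCount (fun r => ((j + 3 : ℕ) : ℤ) ≤ r) m = Fintype.card m.Partition := by
  rw [add_comm, ← rankCount_add_card_not (fun r => ((j + 3 : ℕ) : ℤ) ≤ r), Nat.add_left_cancel_iff,
    rankCount]
  -- With this `r` the bounds in `card_dyson` read rank `≤ j + 2` on partitions of `m` and rank `≥
  -- j` on those of `m + (j + 1)`.
  convert (card_dyson (n := m) (m := m + (j + 1)) (r := j + 1) (by push_cast; ring)).symm using 2
  · refine Finset.filter_congr fun π _ => ?_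
    have h1 := parts_ne_zero_iff_card π
    have h2 := h1.symm.trans (parts_ne_zero_iff_largestPart π)
    rw [h1, rank]
    omega
  · refine Finset.filter_congr fun π _ => ?_
    have h1 := parts_ne_zero_iff_card π
    have h2 := h1.symm.trans (parts_ne_zero_iff_largestPart π)
    rw [h1, rank]
    omega

theorem rankCount_le_neg_add (j m : ℕ) :
    rankCount (fun r => r ≤ -(j : ℤ)) (m + (j + 1)) +
      rankCount (fun r => r ≤ -((j + 3 : ℕ) : ℤ)) m = Fintype.card m.Partition := by
  rw [add_comm, ← rankCount_add_card_not (fun r => r ≤ -((j + 3 : ℕ) : ℤ)),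
    Nat.add_left_cancel_iff, rankCount]
  -- Here the larger partition is the source: rank `≤ -j` is matched with rank `≥ -(j + 2)`.
  convert card_dyson (n := m + (j + 1)) (m := m) (r := -(j + 1)) (by push_cast; ring) using 2
  · refine Finset.filter_congr fun π _ => ?_
    have h1 := parts_ne_zero_iff_card π
    have h2 := h1.symm.trans (parts_ne_zero_iff_largestPart π)
    rw [h1, rank]
    omega
  · refine Finset.filter_congr fun π _ => ?_
    have h1 := parts_ne_zero_iff_card π
    have h2 := h1.symm.trans (parts_ne_zero_iff_largestPart π)
    rw [h1, rank]
    omega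

end RankCount

/-- The recursion shared by `pbar 3`, the partitions of rank at least `j` and those of rank at most
`-j` determines the function. -/
theorem eq_pbar_three_of_recursion {f : ℕ → ℕ → ℕ} (h0 : ∀ j n, n < j + 1 → f j n = 0)
    (h1 : ∀ j m, f j (m + (j + 1)) + f (j + 3) m = Fintype.card m.Partition) (j n : ℕ) :
    pbar 3 (j + 1) n = f j n := by
  induction n using Nat.strong_induction_on generalizing j with
  | _ n ih =>
    rcases lt_or_ge n (j + 1) with h | h
    · rw [h0 j n h, pbar_of_lt three_pos h]
    · obtain ⟨m, rfl⟩ := Nat.exists_eq_add_of_le' h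
      have e1 := pbar_add (A := 3) (m := m) three_pos (Nat.succ_pos j)
      have e2 := p_add_pbar (A := 3) (a := j + 3 + 1) (n := m) three_pos
      have e3 := ih m (by omega) (j + 3)
      have e4 := h1 j m
      have e5 : j + 1 + 3 = j + 3 + 1 := by ring
      simp only [Nat.succ_eq_add_one, e5] at e1
      omega

theorem pbar_three_eq_rankCount_ge (j n : ℕ) :
    pbar 3 (j + 1) n = rankCount (fun r => (j : ℤ) ≤ r) n :=
  eq_pbar_three_of_recursion (f := fun j n => rankCount (fun r => (j : ℤ) ≤ r) n)
    (fun _ _ => rankCount_ge_of_lt) rankCount_ge_add j n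

theorem pbar_three_eq_rankCount_le_neg (j n : ℕ) :
    pbar 3 (j + 1) n = rankCount (fun r => r ≤ -(j : ℤ)) n :=
  eq_pbar_three_of_recursion (f := fun j n => rankCount (fun r => r ≤ -(j : ℤ)) n)
    (fun _ _ => rankCount_le_neg_of_lt) rankCount_le_neg_add j n

theorem rankCount_congr {P Q : ℤ → Prop} [DecidablePred P] [DecidablePred Q] (h : ∀ r, P r ↔ Q r)
    (n : ℕ) : rankCount P n = rankCount Q n := by
  unfold rankCount
  simp_rw [h]

end MexRank

theorem theorem3p3 :
    (∀ j n : ℕ, MexRank.pbar 3 (j + 1) n = MexRank.rankCount (fun r => (j : ℤ) ≤ r) n) ∧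
    (∀ j n : ℕ, 1 ≤ n →
      MexRank.p 3 (j + 1) n = MexRank.rankCount (fun r => r < (j : ℤ)) n) ∧
    (∀ n : ℕ, 1 ≤ n → MexRank.p 3 3 n = MexRank.rankCount (fun r => -1 ≤ r) n) ∧
    (∀ n : ℕ, MexRank.pbar 3 3 n = MexRank.gardenOfEden n) := by
  refine ⟨MexRank.pbar_three_eq_rankCount_ge, fun j n hn => ?_, fun n hn => ?_,
    MexRank.pbar_three_eq_rankCount_le_neg 2⟩
  · have h1 := MexRank.p_add_pbar (A := 3) (a := j + 1) (n := n) three_pos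
    have h2 := MexRank.rankCount_add_not (fun r => (j : ℤ) ≤ r) hn
    rw [← MexRank.pbar_three_eq_rankCount_ge] at h2
    rw [MexRank.rankCount_congr (Q := fun r => ¬ (j : ℤ) ≤ r) (fun r => not_le.symm)]
    omega
  · have h1 := MexRank.p_add_pbar (A := 3) (a := 3) (n := n) three_pos
    have h2 := MexRank.rankCount_add_not (fun r => r ≤ -((2 : ℕ) : ℤ)) hn
    rw [← MexRank.pbar_three_eq_rankCount_le_neg, show 2 + 1 = 3 from rfl] at h2
    rw [MexRank.rankCount_congr (Q := fun r => ¬ r ≤ -((2 : ℕ) : ℤ)) (fun r => by omega)]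
    omega
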